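/- Call a set $U \subseteq \mathbb{R}^2$ in the Euclidean plane a universal covering if $U$ is convex and every set $A \subseteq \mathbb{R}^2$ with $\operatorname{diam}(A) = \sup\{d(x,y) : x, y \in A\} = 1$ is isometric to some subset $B \subseteq U$. Theorem. There exists a universal covering $U$ whose area (two-dimensional Lebesgue measure) satisfies $\operatorname{area}(U) \le 0.8441153$. -/

import Mathlib

/-- The Euclidean plane `ℝ²`. -/
abbrev Plane : Type := EuclideanSpace ℝ (Fin 2)

/-- A universal covering is a convex set `U` in the Euclidean plane such that every set `A` in
the plane of diameter `1` is isometric to a subset `B` of `U`.  (`Metric.diam` is `0` on unbounded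
sets, so `Metric.diam A = 1` says exactly that the supremum of the distances is `1`.) -/
def IsUniversalCovering (U : Set Plane) : Prop :=
  Convex ℝ U ∧ ∀ A : Set Plane, Metric.diam A = 1 → ∃ B : Set Plane, B ⊆ U ∧ Nonempty (A ≃ᵢ B)

/-!
Every set of diameter `1` lies in a set `K` of constant width `1`, and `K` has a circumscribed regular
hexagon `ABCDEF` with opposite sides at distance `1`; by constant width, `K` touches opposite sides in
points which face each other (`IsConstantWidthOne.exists_inscribedInHexagon`).

Cut the corners of the hexagon by lines which are tangent to the inscribed circle and slightly rotated
away from the sides of the inscribed regular dodecagon, all with the same slant.  Cuts at opposite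
corners are parallel and at distance `1`, so `K` avoids one of the two triangles.  Hence, after a
rotation, `K` avoids the triangles at `C` and `E`.  Avoiding `E` keeps the point where `K` touches `DE`
away from `E`, and with it the facing point on `AB` away from `A`; as `K` lies in the unit disc around
the point on `DE`, a region along `AB` near `A` can be removed, and the slant makes it larger than the
corresponding region for the regular dodecagon.

Along `FA` the slant has the opposite effect, but there the loss is avoided by a case distinction with
the cuts of the opposite slant (`InscribedInHexagon.fits_of_avoids_two_four`).  If `K` avoids the
opposite cut at `A`, the region along `FA` is empty because of that cut; if it avoids the one at `C`, it
touches `CD` even further away from `C`.  Otherwise it avoids the opposite cuts at `D` and `F`, and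
the one at `B` or at `E`.  If it is `B`, a reflection of `K` avoids alternating corners and fits.  If it
is `E`, both `K` and its reflection exchanging `D` and `E` are candidates, and they cannot both fail:
`K` would have points on `CD` close to `C` and on `EF` close to `F`, more than `1` apart.

In the coordinates `(x, √3 y)` all data are rational.  The two circular arcs near `A` are replaced by
tangents, so the area is at most that of a polygon with rational vertices, divided by `√3`.
-/

/-! ### Completion to a set of constant width -/

/-- `K` has constant width `1`: its points are pairwise at distance at most `1`, and every unit
vector joins two points of `K`. -/
def IsConstantWidthOne (K : Set Plane) : Prop :=
  (∀ x ∈ K, ∀ y ∈ K, dist x y ≤ 1) ∧ ∀ n : Plane, ‖n‖ = 1 → ∃ p ∈ K, p - n ∈ K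

/-- Zorn's lemma: a set of diameter `1` lies in a compact set which is maximal among the sets whose
points are pairwise at distance at most `1`. -/
theorem exists_isCompact_maximal {A : Set Plane} (hA : Metric.diam A = 1) :
    ∃ K : Set Plane, A ⊆ K ∧ K.Nonempty ∧ IsCompact K ∧ (∀ x ∈ K, ∀ y ∈ K, dist x y ≤ 1) ∧
      ∀ x ∉ K, ∃ y ∈ K, 1 < dist x y := by
  have hne : A.Nonempty := by
    rw [Set.nonempty_iff_ne_empty]
    rintro rfl
    simp at hA
  have hbd : Bornology.IsBounded A := by
    by_contra h
    rw [Metric.diam_eq_zero_of_unbounded h] at hA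
    norm_num at hA
  have hA1 : ∀ x ∈ A, ∀ y ∈ A, dist x y ≤ 1 := fun x hx y hy =>
    hA ▸ Metric.dist_le_diam_of_mem hbd hx hy
  obtain ⟨K, hAK, hK⟩ := zorn_subset_nonempty
    {S : Set Plane | ∀ x ∈ S, ∀ y ∈ S, dist x y ≤ 1} (by
      intro c hc hchain _
      refine ⟨⋃₀ c, ?_, fun s hs => Set.subset_sUnion_of_mem hs⟩
      rintro x ⟨s, hs, hxs⟩ y ⟨t, ht, hyt⟩
      rcases hchain.total hs ht with h | h
      · exact hc ht x (h hxs) y hyt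
      · exact hc hs x hxs y (h hyt)) A hA1
  have hK1 : ∀ x ∈ K, ∀ y ∈ K, dist x y ≤ 1 := hK.prop
  have hmax : ∀ x ∉ K, ∃ y ∈ K, 1 < dist x y := by
    intro x hx
    by_contra! h
    refine hx (hK.le_of_ge (y := insert x K) ?_ (Set.subset_insert x K) (Set.mem_insert x K))
    rintro u (rfl | hu) v (rfl | hv)
    · simp
    · exact h v hv
    · rw [dist_comm]; exact h u hu
    · exact hK1 u hu v hv
  refine ⟨K, hAK, hne.mono hAK, ?_, hK1, hmax⟩
  refine Metric.isCompact_of_isClosed_isBounded ?_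
    (Metric.isBounded_iff.2 ⟨1, fun x hx y hy => hK1 x hx y hy⟩)
  refine isClosed_of_closure_subset fun x hx => ?_
  by_contra hxK
  obtain ⟨y, hy, hxy⟩ := hmax x hxK
  have : closure K ⊆ Metric.closedBall y 1 :=
    closure_minimal (fun z hz => hK1 z hz y hy) Metric.isClosed_closedBall
  exact absurd (this hx) (by simpa using hxy)

/-- At a point `p` of a maximal set `K` where the linear functional `⟪·, n⟫` is largest, some point
of `K` at distance `1` from `p` lies on the side of `p` prescribed by `-τ`.  It is a limit of points
which are too far away from points `p + ετ + ε²n` outside `K`. -/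
theorem exists_dist_eq_one_of_maximal {K : Set Plane} (hcomp : IsCompact K)
    (hK : ∀ x ∈ K, ∀ y ∈ K, dist x y ≤ 1) (hmax : ∀ x ∉ K, ∃ y ∈ K, 1 < dist x y)
    {n τ p : Plane} (hn : inner ℝ n n = 1) (hτ : inner ℝ τ n = 0) (hp : p ∈ K)
    (hpn : ∀ x ∈ K, inner ℝ x n ≤ inner ℝ p n) :
    ∃ q ∈ K, ‖p - q‖ = 1 ∧ 0 ≤ inner ℝ (p - q) τ := by
  let ε : ℕ → ℝ := fun k => 1 / ((k : ℝ) + 1)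
  have hε : ∀ k, 0 < ε k := fun k => by positivity
  have hε0 : Filter.Tendsto ε Filter.atTop (nhds 0) := tendsto_one_div_add_atTop_nhds_zero_nat
  let w : ℕ → Plane := fun k => τ + ε k • n
  have hout : ∀ k, ∃ y ∈ K, 1 < dist (p + ε k • w k) y := by
    intro k
    refine hmax _ fun h => ?_
    have := hpn _ h
    simp only [w, inner_add_left, inner_smul_left, hn, hτ, smul_add] at this
    have h2 := mul_pos (hε k) (hε k)
    simp at this
    nlinarith
  choose y hyK hy using hout
  obtain ⟨q, hq, φ, hφ, hlim⟩ := hcomp.tendsto_subseq hyK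
  have hεφ : Filter.Tendsto (ε ∘ φ) Filter.atTop (nhds 0) := hε0.comp hφ.tendsto_atTop
  have hw : Filter.Tendsto (w ∘ φ) Filter.atTop (nhds τ) := by
    have := (tendsto_const_nhds (x := τ)).add (hεφ.smul_const n)
    simpa [w, Function.comp_def] using this
  have hle : ‖p - q‖ ≤ 1 := by simpa [dist_eq_norm] using hK p hp q hq
  refine ⟨q, hq, le_antisymm hle ?_, ?_⟩
  · have h1 : Filter.Tendsto (fun k => dist (p + ε (φ k) • w (φ k)) (y (φ k)))
        Filter.atTop (nhds (dist (p + (0 : ℝ) • τ) q)) :=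
      (tendsto_const_nhds.add (hεφ.smul hw)).dist hlim
    have := ge_of_tendsto' h1 fun k => (hy (φ k)).le
    simpa [dist_eq_norm] using this
  · have h1 : Filter.Tendsto
        (fun k => 2 * inner ℝ (p - y (φ k)) (w (φ k)) + ε (φ k) * ‖w (φ k)‖ ^ 2)
        Filter.atTop (nhds (2 * inner ℝ (p - q) τ + 0 * ‖τ‖ ^ 2)) :=
      (((tendsto_const_nhds.sub hlim).inner hw).const_mul 2).add (hεφ.mul (hw.norm.pow 2))
    have := ge_of_tendsto' (b := 0) h1 fun k => by
      have h2 := hy (φ k)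
      have h3 : ‖p - y (φ k)‖ ≤ 1 := by
        simpa [dist_eq_norm] using hK p hp _ (hyK (φ k))
      rw [dist_eq_norm, add_sub_right_comm] at h2
      have h4 := norm_add_sq_real (p - y (φ k)) (ε (φ k) • w (φ k))
      rw [inner_smul_right, norm_smul, Real.norm_of_nonneg (hε _).le] at h4
      have h5 : 0 < ε (φ k) * (2 * inner ℝ (p - y (φ k)) (w (φ k)) + ε (φ k) * ‖w (φ k)‖ ^ 2) := by
        nlinarith [norm_nonneg (p - y (φ k))]
      exact (pos_of_mul_pos_right h5 (hε _).le).le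
    linarith

/-- If `u` is a unit vector in the cone spanned by the unit vectors `a`, `b`, then the unit ball around
`-u` contains the intersection of the unit balls around `-a` and `-b`. -/
theorem norm_add_le_one_of_cone {w a b u : Plane} {α β : ℝ} (ha : ‖a‖ = 1) (hb : ‖b‖ = 1)
    (hu : ‖u‖ = 1) (hα : 0 ≤ α) (hβ : 0 ≤ β) (huab : u = α • a + β • b)
    (hwa : ‖w + a‖ ≤ 1) (hwb : ‖w + b‖ ≤ 1) : ‖w + u‖ ≤ 1 := by
  have h1 : 1 ≤ α + β := by
    have := norm_add_le (α • a) (β • b)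
    rwa [← huab, hu, norm_smul, norm_smul, ha, hb, Real.norm_of_nonneg hα, Real.norm_of_nonneg hβ,
      mul_one, mul_one] at this
  have h2 := norm_add_sq_real w a
  have h3 := norm_add_sq_real w b
  have h4 := norm_add_sq_real w u
  have h5 : inner ℝ w u = α * inner ℝ w a + β * inner ℝ w b := by
    rw [huab, inner_add_right, inner_smul_right, inner_smul_right]
  have h6 : ‖w + a‖ ^ 2 ≤ 1 := by nlinarith [norm_nonneg (w + a)]
  have h7 : ‖w + b‖ ^ 2 ≤ 1 := by nlinarith [norm_nonneg (w + b)]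
  rw [ha] at h2; rw [hb] at h3; rw [hu, h5] at h4
  have h8 : ‖w + u‖ ^ 2 ≤ 1 := by
    nlinarith [mul_nonneg hα (by linarith : 0 ≤ -(‖w‖ ^ 2 + 2 * inner ℝ w a)),
      mul_nonneg hβ (by linarith : 0 ≤ -(‖w‖ ^ 2 + 2 * inner ℝ w b)),
      mul_nonneg (sub_nonneg.2 h1) (sq_nonneg ‖w‖)]
  nlinarith [norm_nonneg (w + u)]

theorem inner_plane (x y : Plane) : inner ℝ x y = x 0 * y 0 + x 1 * y 1 := by
  simp [PiLp.inner_apply, Fin.sum_univ_two, mul_comm]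

theorem norm_sq_plane (x : Plane) : ‖x‖ ^ 2 = x 0 ^ 2 + x 1 ^ 2 := by
  rw [← real_inner_self_eq_norm_sq, inner_plane]; ring

/-- Two unit vectors of the upper half plane, one on either side of the vertical axis and at distance
at most `1` from each other, span a cone containing the vertical unit vector. -/
theorem exists_cone_coeff {s t u v : ℝ} (hs : 0 ≤ s) (ht : 0 ≤ t) (hu : 0 ≤ u) (hv : 0 ≤ v)
    (hsu : s ^ 2 + u ^ 2 = 1) (htv : t ^ 2 + v ^ 2 = 1) (hd : (s + t) ^ 2 + (u - v) ^ 2 ≤ 1) :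
    ∃ α β : ℝ, 0 ≤ α ∧ 0 ≤ β ∧ α * u + β * v = 1 ∧ α * s = β * t := by
  rcases eq_or_lt_of_le hs with rfl | hs'
  · exact ⟨1, 0, by norm_num, le_rfl, by nlinarith, by ring⟩
  rcases eq_or_lt_of_le ht with rfl | ht'
  · exact ⟨0, 1, le_rfl, by norm_num, by nlinarith, by ring⟩
  have hD : 0 < t * u + s * v := by
    rcases eq_or_lt_of_le hu with rfl | hu'
    · have : s = 1 := by nlinarith
      subst this
      nlinarith
    · positivity
  refine ⟨t / (t * u + s * v), s / (t * u + s * v), by positivity, by positivity, ?_, ?_⟩ <;>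
    field_simp

/-- Meissner's theorem in the plane: a maximal set of diameter `1` has constant width. -/
theorem isConstantWidthOne_of_maximal {K : Set Plane} (hne : K.Nonempty) (hcomp : IsCompact K)
    (hK : ∀ x ∈ K, ∀ y ∈ K, dist x y ≤ 1) (hmax : ∀ x ∉ K, ∃ y ∈ K, 1 < dist x y) :
    IsConstantWidthOne K := by
  refine ⟨hK, fun n hn => ?_⟩
  obtain ⟨p, hp, hpmax⟩ := hcomp.exists_isMaxOn hne
    (f := fun x => inner ℝ x n) (by fun_prop)
  have hpn : ∀ x ∈ K, inner ℝ x n ≤ inner ℝ p n := fun x hx => hpmax hx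
  refine ⟨p, hp, ?_⟩
  have hn2 : n 0 ^ 2 + n 1 ^ 2 = 1 := by rw [← norm_sq_plane, hn]; norm_num
  let τ : Plane := !₂[-n 1, n 0]
  have hτn : inner ℝ τ n = 0 := by rw [inner_plane]; simp [τ]; ring
  have hnn : inner ℝ n n = 1 := by rw [inner_plane]; linarith
  obtain ⟨q, hq, hpq, hqτ⟩ := exists_dist_eq_one_of_maximal hcomp hK hmax hnn hτn hp hpn
  obtain ⟨r, hr, hpr, hrτ⟩ := exists_dist_eq_one_of_maximal hcomp hK hmax hnn
    (τ := -τ) (by rw [inner_neg_left, hτn, neg_zero]) hp hpn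
  -- `n` lies in the cone spanned by the unit vectors `a = p - q` and `b = p - r`.
  set a := p - q with ha
  set b := p - r with hb
  have han : 0 ≤ inner ℝ a n := by rw [ha, inner_sub_left]; linarith [hpn q hq]
  have hbn : 0 ≤ inner ℝ b n := by rw [hb, inner_sub_left]; linarith [hpn r hr]
  have hab : ‖a - b‖ ≤ 1 := by
    have : a - b = r - q := by rw [ha, hb]; abel
    rw [this, ← dist_eq_norm]; exact hK r hr q hq
  have hcone : ∃ α β : ℝ, 0 ≤ α ∧ 0 ≤ β ∧ n = α • a + β • b := by
    have ha2 : a 0 ^ 2 + a 1 ^ 2 = 1 := by rw [← norm_sq_plane, hpq]; norm_num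
    have hb2 : b 0 ^ 2 + b 1 ^ 2 = 1 := by rw [← norm_sq_plane, hpr]; norm_num
    have hab2 : (a 0 - b 0) ^ 2 + (a 1 - b 1) ^ 2 ≤ 1 := by
      have := norm_sq_plane (a - b)
      simp only [PiLp.sub_apply] at this
      nlinarith [norm_nonneg (a - b)]
    rw [inner_neg_right] at hrτ
    rw [inner_plane] at hqτ hrτ han hbn
    simp only [τ, Matrix.cons_val_zero, Matrix.cons_val_one] at hqτ hrτ
    obtain ⟨α, β, hα, hβ, h1, h2⟩ := exists_cone_coeff hqτ hrτ han hbn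
      (by linear_combination (n 0 ^ 2 + n 1 ^ 2) * ha2 + hn2)
      (by linear_combination (n 0 ^ 2 + n 1 ^ 2) * hb2 + hn2)
      (by
        have : ((a 0 - b 0) ^ 2 + (a 1 - b 1) ^ 2) * (n 0 ^ 2 + n 1 ^ 2) ≤ 1 := by
          rw [hn2, mul_one]; exact hab2
        linarith)
    refine ⟨α, β, hα, hβ, ?_⟩
    ext i
    fin_cases i
    · simp
      linear_combination -n 0 * h1 + n 1 * h2 + (α * a 0 + β * b 0) * hn2
    · simp
      linear_combination -n 1 * h1 - n 0 * h2 + (α * a 1 + β * b 1) * hn2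
  obtain ⟨α, β, hα, hβ, hnab⟩ := hcone
  by_contra hpnK
  obtain ⟨z, hz, hzd⟩ := hmax _ hpnK
  have h1 : ‖(z - p) + n‖ ≤ 1 := by
    refine norm_add_le_one_of_cone hpq hpr hn hα hβ hnab ?_ ?_
    · rw [ha, sub_add_sub_cancel, ← dist_eq_norm]; exact hK z hz q hq
    · rw [hb, sub_add_sub_cancel, ← dist_eq_norm]; exact hK z hz r hr
  rw [dist_comm, dist_eq_norm, sub_sub_eq_add_sub, add_sub_right_comm] at hzd
  linarith

/-! ### Coordinates and rigid motions -/

/-- The first coordinate of a point of the plane. -/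
def xc (v : Plane) : ℝ := v 0

/-- The second coordinate of a point of the plane, multiplied by `√3`.  In the coordinates `xc`, `yc`
the regular hexagon has rational vertices and its symmetries have rational matrices. -/
noncomputable def yc (v : Plane) : ℝ := √3 * v 1

theorem dist_sq_plane (p q : Plane) :
    dist p q ^ 2 = (xc p - xc q) ^ 2 + (yc p - yc q) ^ 2 / 3 := by
  have h3 : √3 ^ 2 = 3 := Real.sq_sqrt (by norm_num)
  rw [dist_eq_norm, norm_sq_plane]
  simp only [PiLp.sub_apply, xc, yc]
  linear_combination -(p 1 - q 1) ^ 2 / 3 * h3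

/-- The rotation with cosine `c` and sine `s` followed by the translation by `(a, b)`. -/
def rigidMotion (c s a b : ℝ) (h : c ^ 2 + s ^ 2 = 1) : Plane ≃ᵢ Plane where
  toFun v := !₂[c * v 0 - s * v 1 + a, s * v 0 + c * v 1 + b]
  invFun v := !₂[c * (v 0 - a) + s * (v 1 - b), -s * (v 0 - a) + c * (v 1 - b)]
  left_inv v := by
    ext i
    fin_cases i
    · simp
      linear_combination v 0 * h
    · simp
      linear_combination v 1 * h
  right_inv v := by
    ext i
    fin_cases i
    · simp
      linear_combination (v 0 - a) * h
    · simp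
      linear_combination (v 1 - b) * h
  isometry_toFun := Isometry.of_dist_eq fun p q => by
    rw [← sq_eq_sq₀ dist_nonneg dist_nonneg, dist_eq_norm, dist_eq_norm, norm_sq_plane,
      norm_sq_plane]
    simp
    linear_combination ((p 0 - q 0) ^ 2 + (p 1 - q 1) ^ 2) * h

/-- The reflection in the vertical axis. -/
def mirror : Plane ≃ᵢ Plane where
  toFun v := !₂[-v 0, v 1]
  invFun v := !₂[-v 0, v 1]
  left_inv v := by ext i; fin_cases i <;> simp
  right_inv v := by ext i; fin_cases i <;> simp
  isometry_toFun := Isometry.of_dist_eq fun p q => by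
    rw [← sq_eq_sq₀ dist_nonneg dist_nonneg, dist_eq_norm, dist_eq_norm, norm_sq_plane,
      norm_sq_plane]
    simp
    ring

theorem xc_mirror (v : Plane) : xc (mirror v) = -xc v := by
  change xc !₂[-v 0, v 1] = -xc v
  simp [xc]

theorem yc_mirror (v : Plane) : yc (mirror v) = yc v := by
  change yc !₂[-v 0, v 1] = yc v
  simp [yc]

/-- The rotation by `60°` about the origin. -/
noncomputable def hexRotation : Plane ≃ᵢ Plane :=
  rigidMotion (1 / 2) (√3 / 2) 0 0 (by
    have h3 : √3 ^ 2 = 3 := Real.sq_sqrt (by norm_num)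
    linear_combination h3 / 4)

theorem xc_hexRotation (v : Plane) : xc (hexRotation v) = (xc v - yc v) / 2 := by
  change xc !₂[1 / 2 * v 0 - √3 / 2 * v 1 + 0, √3 / 2 * v 0 + 1 / 2 * v 1 + 0] = _
  simp [xc, yc]
  ring

theorem yc_hexRotation (v : Plane) : yc (hexRotation v) = (3 * xc v + yc v) / 2 := by
  have h3 : √3 ^ 2 = 3 := Real.sq_sqrt (by norm_num)
  change yc !₂[1 / 2 * v 0 - √3 / 2 * v 1 + 0, √3 / 2 * v 0 + 1 / 2 * v 1 + 0] = _
  simp [xc, yc]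
  linear_combination v 0 / 2 * h3

/-! ### The circumscribed regular hexagon -/

/-- In the coordinates `xc`, `yc`, let `A = (0, 1)`, `B = (1/2, 1/2)`, `C = (1/2, -1/2)`,
`D = (0, -1)`, `E = (-1/2, -1/2)`, `F = (-1/2, 1/2)` be the vertices of the regular hexagon whose
opposite sides are at distance `1`.  The points of `K` are pairwise at distance at most `1`, and on
each two opposite sidelines `K` has two points which face each other. -/
structure InscribedInHexagon (K : Set Plane) : Prop where
  dist_le : ∀ p ∈ K, ∀ q ∈ K, (xc p - xc q) ^ 2 + (yc p - yc q) ^ 2 / 3 ≤ 1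
  touch_BC : ∃ p ∈ K, ∃ q ∈ K, xc p = 1 / 2 ∧ xc q = -1 / 2 ∧ yc q = yc p
  touch_CD : ∃ p ∈ K, ∃ q ∈ K, xc p - yc p = 1 ∧ xc q = xc p - 1 / 2 ∧ yc q = yc p + 3 / 2
  touch_DE : ∃ p ∈ K, ∃ q ∈ K, xc p + yc p = -1 ∧ xc q = xc p + 1 / 2 ∧ yc q = yc p + 3 / 2

theorem cos_sin_add_two_pi_div_three (θ : ℝ) :
    Real.cos (θ + 2 * Real.pi / 3) = -Real.cos θ / 2 - √3 / 2 * Real.sin θ ∧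
    Real.sin (θ + 2 * Real.pi / 3) = -Real.sin θ / 2 + √3 / 2 * Real.cos θ := by
  have h : 2 * Real.pi / 3 = Real.pi - Real.pi / 3 := by ring
  rw [Real.cos_add, Real.sin_add, h, Real.cos_pi_sub, Real.sin_pi_sub, Real.cos_pi_div_three,
    Real.sin_pi_div_three]
  constructor <;> ring

theorem cos_sin_add_four_pi_div_three (θ : ℝ) :
    Real.cos (θ + 4 * Real.pi / 3) = -Real.cos θ / 2 + √3 / 2 * Real.sin θ ∧
    Real.sin (θ + 4 * Real.pi / 3) = -Real.sin θ / 2 - √3 / 2 * Real.cos θ := by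
  have h : θ + 4 * Real.pi / 3 = θ + Real.pi / 3 + Real.pi := by ring
  rw [h, Real.cos_add_pi, Real.sin_add_pi, Real.cos_add, Real.sin_add, Real.cos_pi_div_three,
    Real.sin_pi_div_three]
  constructor <;> ring

/-- A set of constant width `1` has a circumscribed regular hexagon.  The signed distance from the
intersection of two of the three midlines of the circumscribed strips at angles `θ`, `θ + 120°`,
`θ + 240°` to the third midline changes sign when `θ` grows by `180°`, so for some `θ` the midlines
are concurrent. -/
theorem IsConstantWidthOne.exists_inscribedInHexagon {K : Set Plane} (hK : IsConstantWidthOne K) :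
    ∃ g : Plane ≃ᵢ Plane, InscribedInHexagon (g '' K) := by
  obtain ⟨hdist, hw⟩ := hK
  let n : ℝ → Plane := fun θ => !₂[Real.cos θ, Real.sin θ]
  have hn : ∀ θ, ‖n θ‖ = 1 := fun θ => by
    have := norm_sq_plane (n θ)
    rw [show n θ 0 = Real.cos θ from rfl, show n θ 1 = Real.sin θ from rfl,
      Real.cos_sq_add_sin_sq] at this
    nlinarith [norm_nonneg (n θ)]
  choose p hp hpn using fun θ => hw (n θ) (hn θ)
  -- `h` is the support function of `K`.
  let h : ℝ → ℝ := fun θ => inner ℝ (p θ) (n θ)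
  have hself : ∀ θ, inner ℝ (n θ) (n θ) = (1 : ℝ) := fun θ => by
    rw [real_inner_self_eq_norm_sq, hn]; norm_num
  have hle : ∀ θ, ∀ x ∈ K, inner ℝ x (n θ) ≤ h θ := fun θ x hx => by
    have h1 := real_inner_le_norm (x - (p θ - n θ)) (n θ)
    rw [hn, mul_one, ← dist_eq_norm, inner_sub_left, inner_sub_left, hself] at h1
    linarith [hdist x hx _ (hpn θ)]
  have hge : ∀ θ, ∀ x ∈ K, h θ - 1 ≤ inner ℝ x (n θ) := fun θ x hx => by
    have h1 := real_inner_le_norm (p θ - x) (n θ)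
    rw [hn, mul_one, ← dist_eq_norm, inner_sub_left] at h1
    linarith [hdist _ (hp θ) x hx]
  have hpi : ∀ θ, h (θ + Real.pi) = 1 - h θ := fun θ => by
    have hneg : n (θ + Real.pi) = -n θ := by
      ext i
      fin_cases i <;> simp [n]
    have h1 := hle (θ + Real.pi) _ (hpn θ)
    have h2 := hge θ _ (hp (θ + Real.pi))
    have h3 : h (θ + Real.pi) = -inner ℝ (p (θ + Real.pi)) (n θ) := by
      simp only [h, hneg, inner_neg_right]
    rw [hneg, inner_neg_right, inner_sub_left, hself] at h1
    exact le_antisymm (by linarith) (by linarith)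
  have hcont : Continuous h := by
    have hnc : Continuous n := by
      refine (PiLp.continuous_toLp 2 _).comp (continuous_pi fun i => ?_)
      fin_cases i
      · exact Real.continuous_cos
      · exact Real.continuous_sin
    set M := ‖p 0‖ + 1
    have hM : ∀ x ∈ K, ‖x‖ ≤ M := fun x hx => by
      have h1 := norm_le_norm_add_norm_sub (p 0) x
      have h2 := hdist _ (hp 0) x hx
      rw [dist_eq_norm] at h2
      linarith
    have hlip : ∀ θ φ, h θ - h φ ≤ M * ‖n θ - n φ‖ := fun θ φ => by
      have h1 := hle φ _ (hp θ)
      have h2 := real_inner_le_norm (p θ) (n θ - n φ)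
      rw [inner_sub_right] at h2
      have h3 := mul_le_mul_of_nonneg_right (hM _ (hp θ)) (norm_nonneg (n θ - n φ))
      change inner ℝ (p θ) (n θ) - h φ ≤ _
      linarith
    rw [continuous_iff_continuousAt]
    intro θ
    have h0 : Filter.Tendsto (fun φ => M * ‖n φ - n θ‖) (nhds θ) (nhds 0) := by
      have : Continuous fun φ => M * ‖n φ - n θ‖ := by fun_prop
      simpa using this.tendsto θ
    refine tendsto_iff_norm_sub_tendsto_zero.2 (squeeze_zero (fun _ => norm_nonneg _) (fun φ => ?_) h0)
    rw [Real.norm_eq_abs, abs_le]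
    have h1 := hlip θ φ
    rw [norm_sub_rev] at h1
    exact ⟨by linarith, hlip φ θ⟩
  obtain ⟨θ, hθ⟩ : ∃ θ, h θ + h (θ + 2 * Real.pi / 3) + h (θ + 4 * Real.pi / 3) = 3 / 2 := by
    let f : ℝ → ℝ := fun θ => h θ + h (θ + 2 * Real.pi / 3) + h (θ + 4 * Real.pi / 3)
    have hf : Continuous f := by fun_prop
    have hfpi : f 0 + f Real.pi = 3 := by
      have h1 := hpi 0
      have h2 := hpi (0 + 2 * Real.pi / 3)
      have h3 := hpi (0 + 4 * Real.pi / 3)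
      rw [add_right_comm] at h2 h3
      rw [zero_add] at h1
      simp only [f]
      rw [zero_add Real.pi] at h2 h3
      linarith
    rcases le_total (f 0) (3 / 2) with h0 | h0
    · obtain ⟨θ, -, hθ⟩ := intermediate_value_Icc Real.pi_pos.le hf.continuousOn
        (show (3 / 2 : ℝ) ∈ Set.Icc (f 0) (f Real.pi) from ⟨h0, by linarith⟩)
      exact ⟨θ, hθ⟩
    · obtain ⟨θ, -, hθ⟩ := intermediate_value_Icc' Real.pi_pos.le hf.continuousOn
        (show (3 / 2 : ℝ) ∈ Set.Icc (f Real.pi) (f 0) from ⟨by linarith, h0⟩)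
      exact ⟨θ, hθ⟩
  have hcs := Real.cos_sq_add_sin_sq θ
  have h3 : √3 ^ 2 = 3 := Real.sq_sqrt (by norm_num)
  obtain ⟨c1, s1⟩ := cos_sin_add_two_pi_div_three θ
  obtain ⟨c2, s2⟩ := cos_sin_add_four_pi_div_three θ
  have e0 : h θ = p θ 0 * Real.cos θ + p θ 1 * Real.sin θ := inner_plane _ _
  have e1 : h (θ + 2 * Real.pi / 3) = p (θ + 2 * Real.pi / 3) 0 * Real.cos (θ + 2 * Real.pi / 3) +
    p (θ + 2 * Real.pi / 3) 1 * Real.sin (θ + 2 * Real.pi / 3) := inner_plane _ _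
  have e2 : h (θ + 4 * Real.pi / 3) = p (θ + 4 * Real.pi / 3) 0 * Real.cos (θ + 4 * Real.pi / 3) +
    p (θ + 4 * Real.pi / 3) 1 * Real.sin (θ + 4 * Real.pi / 3) := inner_plane _ _
  let g := rigidMotion (Real.cos θ) (-Real.sin θ) (-(h θ - 1 / 2))
    (-√3 * ((2 * (h (θ + 2 * Real.pi / 3) - 1 / 2) + (h θ - 1 / 2)) / 3)) (by simp)
  have hgx : ∀ v, xc (g v) = Real.cos θ * v 0 + Real.sin θ * v 1 - (h θ - 1 / 2) := fun v => by
    change Real.cos θ * v 0 - -Real.sin θ * v 1 + _ = _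
    ring
  have hgy : ∀ v, yc (g v) = √3 * (-Real.sin θ * v 0 + Real.cos θ * v 1) -
      (2 * (h (θ + 2 * Real.pi / 3) - 1 / 2) + (h θ - 1 / 2)) := fun v => by
    change √3 * (-Real.sin θ * v 0 + Real.cos θ * v 1 + _) = _
    linear_combination (-((2 * (h (θ + 2 * Real.pi / 3) - 1 / 2) + (h θ - 1 / 2)) / 3)) * h3
  refine ⟨g, ?_, ?_, ?_, ?_⟩
  · rintro _ ⟨x, hx, rfl⟩ _ ⟨y, hy, rfl⟩
    rw [← dist_sq_plane, g.isometry.dist_eq]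
    nlinarith [hdist x hx y hy, dist_nonneg (x := x) (y := y)]
  · refine ⟨_, ⟨_, hp θ, rfl⟩, _, ⟨_, hpn θ, rfl⟩, ?_⟩
    simp only [hgx, hgy, PiLp.sub_apply, n, Matrix.cons_val_zero, Matrix.cons_val_one]
    refine ⟨?_, ?_, ?_⟩
    · linarith
    · linarith
    · ring
  · refine ⟨_, ⟨_, hpn (θ + 2 * Real.pi / 3), rfl⟩, _, ⟨_, hp (θ + 2 * Real.pi / 3), rfl⟩, ?_⟩
    simp only [hgx, hgy, PiLp.sub_apply, n, Matrix.cons_val_zero, Matrix.cons_val_one]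
    rw [c1, s1] at e1 ⊢
    refine ⟨?_, ?_, ?_⟩
    · linear_combination 2 * e1 + 2 * hcs + (Real.cos θ ^ 2 + Real.sin θ ^ 2) / 2 * h3
    · linear_combination (-1 / 2) * hcs
    · linear_combination (3 / 2) * hcs + (Real.cos θ ^ 2 + Real.sin θ ^ 2) / 2 * h3
  · refine ⟨_, ⟨_, hp (θ + 4 * Real.pi / 3), rfl⟩, _, ⟨_, hpn (θ + 4 * Real.pi / 3), rfl⟩, ?_⟩
    simp only [hgx, hgy, PiLp.sub_apply, n, Matrix.cons_val_zero, Matrix.cons_val_one]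
    rw [c2, s2] at e2 ⊢
    refine ⟨?_, ?_, ?_⟩
    · linear_combination 2 * e2 - 2 * hθ
    · linear_combination (1 / 2) * hcs
    · linear_combination (3 / 2) * hcs + (Real.cos θ ^ 2 + Real.sin θ ^ 2) / 2 * h3

/-! ### Slanted cuts at the corners of the hexagon -/

/-- The linear functional whose values above `1/2` are cut off from the corner `A = (0, 1)`; its
coefficient vector is a unit vector, turned away from the direction of the corner towards the side
`FA` for `σ = 1` and towards the side `AB` for `σ = -1`. -/
noncomputable def cutForm (σ : ℝ) (v : Plane) : ℝ := (-(169 * σ) * xc v + 4340 * yc v) / 7519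

/-- `K` avoids the open triangle which the cut with slant `σ` takes from the corner number `i`, where
the corners `A`, `B`, `C`, `D`, `E`, `F` have the numbers `0`, …, `5` modulo `6`. -/
def Avoids (K : Set Plane) (σ : ℝ) (i : ℕ) : Prop :=
  ∀ v ∈ K, cutForm σ (hexRotation^[i] v) ≤ 1 / 2

/-- The Cauchy–Schwarz inequality for the Euclidean norm in the coordinates `xc`, `yc`. -/
theorem linear_le_of_sq_le {α β x y N : ℝ} (hN : 0 ≤ N) (hαβ : α ^ 2 + 3 * β ^ 2 ≤ N ^ 2)
    (hxy : x ^ 2 + y ^ 2 / 3 ≤ 1) : α * x + β * y ≤ N := by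
  refine le_of_sq_le_sq (?_ : _ ≤ N ^ 2) hN
  have h1 : (α * x + β * y) ^ 2 ≤ (α ^ 2 + 3 * β ^ 2) * (x ^ 2 + y ^ 2 / 3) := by
    nlinarith [sq_nonneg (α * y - 3 * β * x)]
  have h2 : (α ^ 2 + 3 * β ^ 2) * (x ^ 2 + y ^ 2 / 3) ≤ (α ^ 2 + 3 * β ^ 2) * 1 :=
    mul_le_mul_of_nonneg_left hxy (by positivity)
  linarith

theorem dist_iterate_hexRotation (i : ℕ) (v w : Plane) :
    dist (hexRotation^[i] v) (hexRotation^[i] w) = dist v w := by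
  induction i with
  | zero => rfl
  | succ i ih =>
    rw [Function.iterate_succ_apply', Function.iterate_succ_apply', hexRotation.isometry.dist_eq, ih]

theorem cutForm_iterate_add_three (σ : ℝ) (i : ℕ) (v : Plane) :
    cutForm σ (hexRotation^[i + 3] v) = -cutForm σ (hexRotation^[i] v) := by
  rw [add_comm i 3, Function.iterate_add_apply]
  simp only [cutForm, Function.iterate_succ, Function.iterate_zero, Function.comp_apply, id_eq,
    xc_hexRotation, yc_hexRotation]
  ring

theorem Avoids.add_six {K : Set Plane} {σ : ℝ} {i : ℕ} (h : Avoids K σ i) :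
    Avoids K σ (i + 6) := fun v hv => by
  rw [show i + 6 = i + 3 + 3 from rfl, cutForm_iterate_add_three, cutForm_iterate_add_three, neg_neg]
  exact h v hv

theorem avoids_hexRotation_image {K : Set Plane} {σ : ℝ} {i : ℕ} :
    Avoids (hexRotation '' K) σ i ↔ Avoids K σ (i + 1) := by
  simp only [Avoids, Set.forall_mem_image, Function.iterate_succ, Function.comp_apply]

theorem avoids_mirror_image {K : Set Plane} {σ : ℝ} {i j : ℕ} (hij : i + j = 6)
    (h : Avoids K (-σ) j) : Avoids (mirror '' K) σ i := by
  rintro _ ⟨v, hv, rfl⟩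
  refine le_of_eq_of_le ?_ (h v hv)
  obtain rfl : j = 6 - i := by omega
  have hi : i ≤ 6 := by omega
  interval_cases i <;>
  · simp only [cutForm, Function.iterate_succ, Function.iterate_zero, Function.comp_apply, id_eq,
      xc_hexRotation, yc_hexRotation, xc_mirror, yc_mirror, Nat.sub_zero, Nat.reduceSub]
    ring

namespace InscribedInHexagon

variable {K : Set Plane}

theorem hexRotation_image (hK : InscribedInHexagon K) :
    InscribedInHexagon (hexRotation '' K) := by
  obtain ⟨hd, ⟨p₁, hp₁, q₁, hq₁, h₁⟩, ⟨p₂, hp₂, q₂, hq₂, h₂⟩, ⟨p₃, hp₃, q₃, hq₃, h₃⟩⟩ := hK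
  refine ⟨?_, ⟨_, ⟨p₂, hp₂, rfl⟩, _, ⟨q₂, hq₂, rfl⟩, ?_⟩, ⟨_, ⟨p₃, hp₃, rfl⟩, _, ⟨q₃, hq₃, rfl⟩, ?_⟩,
    ⟨_, ⟨q₁, hq₁, rfl⟩, _, ⟨p₁, hp₁, rfl⟩, ?_⟩⟩
  · rintro _ ⟨x, hx, rfl⟩ _ ⟨y, hy, rfl⟩
    rw [← dist_sq_plane, hexRotation.isometry.dist_eq, dist_sq_plane]
    exact hd x hx y hy
  all_goals
    simp only [xc_hexRotation, yc_hexRotation]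
    refine ⟨?_, ?_, ?_⟩ <;> linarith

theorem mirror_image (hK : InscribedInHexagon K) : InscribedInHexagon (mirror '' K) := by
  obtain ⟨hd, ⟨p₁, hp₁, q₁, hq₁, h₁⟩, ⟨p₂, hp₂, q₂, hq₂, h₂⟩, ⟨p₃, hp₃, q₃, hq₃, h₃⟩⟩ := hK
  refine ⟨?_, ⟨_, ⟨q₁, hq₁, rfl⟩, _, ⟨p₁, hp₁, rfl⟩, ?_⟩, ⟨_, ⟨p₃, hp₃, rfl⟩, _, ⟨q₃, hq₃, rfl⟩, ?_⟩,
    ⟨_, ⟨p₂, hp₂, rfl⟩, _, ⟨q₂, hq₂, rfl⟩, ?_⟩⟩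
  · rintro _ ⟨x, hx, rfl⟩ _ ⟨y, hy, rfl⟩
    rw [← dist_sq_plane, mirror.isometry.dist_eq, dist_sq_plane]
    exact hd x hx y hy
  all_goals
    simp only [xc_mirror, yc_mirror]
    refine ⟨?_, ?_, ?_⟩ <;> linarith

/-- The two cuts with the same slant at opposite corners lie on parallel lines at distance `1`, so
`K` cannot enter both triangles. -/
theorem avoids_or_avoids_add_three (hK : InscribedInHexagon K) {σ : ℝ} (hσ : σ ^ 2 = 1) (i : ℕ) :
    Avoids K σ i ∨ Avoids K σ (i + 3) := by
  by_contra! h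
  simp only [Avoids, cutForm_iterate_add_three, not_forall, not_le] at h
  obtain ⟨⟨v, hv, hv'⟩, w, hw, hw'⟩ := h
  have hd : dist (hexRotation^[i] v) (hexRotation^[i] w) = dist v w :=
    dist_iterate_hexRotation i v w
  have h1 := hK.dist_le v hv w hw
  rw [← dist_sq_plane, ← hd, dist_sq_plane] at h1
  have h2 := linear_le_of_sq_le (α := -(169 * σ)) (β := 4340) (N := 7519) (by norm_num)
    (by nlinarith) h1
  simp only [cutForm] at hv' hw'
  linarith

end InscribedInHexagon

/-! ### The universal covering -/

/-- The covering: the regular hexagon without the two triangles cut off from the corners `C` and `E`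
with slant `1`, and near the corner `A` also without the points that lie above certain tangents of
two unit circles.  Their centers `(-35/97, -62/97)` and `(36603/100000, -63397/100000)` lie on the
sides `DE` and `CD`, the first where the cut at `E` meets `DE`.  For `t = 0` the tangents would be the
sidelines `AB` and `FA`, touching the circles opposite the centers; as `t` grows the point of tangency
moves towards `A`, by an angle whose half has tangent `√3 t`.  The second family starts at a positive
`t`, since its first members would cut into sets which avoid the cut of slant `-1` at `A`. -/
def covering : Set Plane :=
  {v | xc v ≤ 1 / 2 ∧ -1 / 2 ≤ xc v ∧ xc v + yc v ≤ 1 ∧ -1 ≤ xc v + yc v ∧ yc v - xc v ≤ 1 ∧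
    -1 ≤ yc v - xc v ∧
    cutForm 1 (hexRotation^[2] v) ≤ 1 / 2 ∧ cutForm 1 (hexRotation^[4] v) ≤ 1 / 2 ∧
    (∀ t : ℝ, 0 ≤ t → (1 - 3 * t ^ 2 - 6 * t) * (xc v + 35 / 97) +
      (1 - 3 * t ^ 2 + 2 * t) * (yc v + 62 / 97) ≤ 2 * (1 + 3 * t ^ 2)) ∧
    ∀ t : ℝ, 7 / 2000 ≤ t → t ≤ 1 / 10 →
      -(1 - 3 * t ^ 2 - 6 * t) * (xc v - 36603 / 100000) +
        (1 - 3 * t ^ 2 + 2 * t) * (yc v + 63397 / 100000) ≤ 2 * (1 + 3 * t ^ 2)}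

/-- Some isometric copy of `K` lies in the covering. -/
def Fits (K : Set Plane) : Prop := ∃ g : Plane ≃ᵢ Plane, g '' K ⊆ covering

theorem Fits.of_image {K : Set Plane} (g : Plane ≃ᵢ Plane) (h : Fits (g '' K)) : Fits K := by
  obtain ⟨f, hf⟩ := h
  refine ⟨g.trans f, ?_⟩
  rintro _ ⟨v, hv, rfl⟩
  exact hf ⟨g v, ⟨v, hv, rfl⟩, rfl⟩

theorem Fits.of_subset {K : Set Plane} (h : K ⊆ covering) : Fits K := by
  refine ⟨IsometryEquiv.refl _, ?_⟩
  rintro _ ⟨v, hv, rfl⟩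
  exact h hv

theorem convex_covering : Convex ℝ covering := by
  rintro v hv w hw a b ha hb hab
  have hx : xc (a • v + b • w) = a * xc v + b * xc w := by simp [xc]
  have hy : yc (a • v + b • w) = a * yc v + b * yc w := by simp [yc]; ring
  obtain rfl : b = 1 - a := by linarith
  simp only [covering, Set.mem_ofPred_eq, cutForm, Function.iterate_succ, Function.iterate_zero,
    Function.comp_apply, id_eq, xc_hexRotation, yc_hexRotation, hx, hy] at hv hw ⊢
  obtain ⟨v1, v2, v3, v4, v5, v6, v7, v8, v9, v10⟩ := hv
  obtain ⟨w1, w2, w3, w4, w5, w6, w7, w8, w9, w10⟩ := hw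
  refine ⟨?_, ?_, ?_, ?_, ?_, ?_, ?_, ?_, fun t ht => ?_, fun t ht ht' => ?_⟩
  · linarith [mul_le_mul_of_nonneg_left v1 ha, mul_le_mul_of_nonneg_left w1 hb]
  · linarith [mul_le_mul_of_nonneg_left v2 ha, mul_le_mul_of_nonneg_left w2 hb]
  · linarith [mul_le_mul_of_nonneg_left v3 ha, mul_le_mul_of_nonneg_left w3 hb]
  · linarith [mul_le_mul_of_nonneg_left v4 ha, mul_le_mul_of_nonneg_left w4 hb]
  · linarith [mul_le_mul_of_nonneg_left v5 ha, mul_le_mul_of_nonneg_left w5 hb]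
  · linarith [mul_le_mul_of_nonneg_left v6 ha, mul_le_mul_of_nonneg_left w6 hb]
  · linarith [mul_le_mul_of_nonneg_left v7 ha, mul_le_mul_of_nonneg_left w7 hb]
  · linarith [mul_le_mul_of_nonneg_left v8 ha, mul_le_mul_of_nonneg_left w8 hb]
  · have h1 := mul_le_mul_of_nonneg_left (v9 t ht) ha
    have h2 := mul_le_mul_of_nonneg_left (w9 t ht) hb
    linarith
  · have h1 := mul_le_mul_of_nonneg_left (v10 t ht ht') ha
    have h2 := mul_le_mul_of_nonneg_left (w10 t ht ht') hb
    linarith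

/-! ### Placing a set in the covering -/

namespace InscribedInHexagon

variable {K : Set Plane}

/-- A set which avoids the cuts at `C` and `E` lies in the covering, provided that it touches the
side `CD` far enough from `C`, or avoids the cut of the opposite slant at `A`. -/
theorem subset_covering (hK : InscribedInHexagon K) (h2 : Avoids K 1 2) (h4 : Avoids K 1 4)
    (h : (∃ p ∈ K, xc p - yc p = 1 ∧ xc p ≤ 36603 / 100000) ∨ Avoids K (-1) 0) :
    K ⊆ covering := by
  intro v hv
  obtain ⟨hd, ⟨p₁, hp₁, q₁, hq₁, e₁, e₁', e₁''⟩, ⟨p₂, hp₂, q₂, hq₂, e₂, e₂', e₂''⟩,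
    ⟨p₃, hp₃, q₃, hq₃, e₃, e₃', e₃''⟩⟩ := hK
  have hFA : yc v - xc v ≤ 1 := by
    have := linear_le_of_sq_le (α := -1 / 2) (β := 1 / 2) (N := 1) (by norm_num) (by norm_num)
      (hd v hv p₂ hp₂)
    linarith
  refine ⟨?_, ?_, ?_, ?_, hFA, ?_, h2 v hv, h4 v hv, fun t ht => ?_, fun t ht ht' => ?_⟩
  · have := linear_le_of_sq_le (α := 1) (β := 0) (N := 1) (by norm_num) (by norm_num)
      (hd v hv q₁ hq₁)
    linarith
  · have := linear_le_of_sq_le (α := -1) (β := 0) (N := 1) (by norm_num) (by norm_num)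
      (hd v hv p₁ hp₁)
    linarith
  · have := linear_le_of_sq_le (α := 1 / 2) (β := 1 / 2) (N := 1) (by norm_num) (by norm_num)
      (hd v hv p₃ hp₃)
    linarith
  · have := linear_le_of_sq_le (α := -1 / 2) (β := -1 / 2) (N := 1) (by norm_num) (by norm_num)
      (hd v hv q₃ hq₃)
    linarith
  · have := linear_le_of_sq_le (α := 1 / 2) (β := -1 / 2) (N := 1) (by norm_num) (by norm_num)
      (hd v hv q₂ hq₂)
    linarith
  · -- `p₃` is a point of `K` on `DE`, and the cut at `E` keeps it away from `E`.
    have h1 := linear_le_of_sq_le (α := 1 - 3 * t ^ 2 - 6 * t) (β := 1 - 3 * t ^ 2 + 2 * t)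
      (N := 2 * (1 + 3 * t ^ 2)) (by positivity) (le_of_eq (by ring)) (hd v hv p₃ hp₃)
    have h5 := h4 p₃ hp₃
    simp only [cutForm, Function.iterate_succ, Function.iterate_zero, Function.comp_apply, id_eq,
      xc_hexRotation, yc_hexRotation] at h5
    have h6 : 0 ≤ xc p₃ + 35 / 97 := by linarith
    obtain h7 : yc p₃ = -1 - xc p₃ := by linarith
    rw [h7] at h1
    linarith [mul_nonneg ht h6]
  · rcases h with ⟨p, hp, ep, hpC⟩ | h0
    · have h1 := linear_le_of_sq_le (α := -(1 - 3 * t ^ 2 - 6 * t)) (β := 1 - 3 * t ^ 2 + 2 * t)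
        (N := 2 * (1 + 3 * t ^ 2)) (by positivity) (le_of_eq (by ring)) (hd v hv p hp)
      obtain h7 : yc p = xc p - 1 := by linarith
      rw [h7] at h1
      linarith [mul_nonneg (by linarith : 0 ≤ t) (sub_nonneg.2 hpC)]
    · -- The normal of the tangent is a nonnegative combination of those of `FA` and of the cut.
      have h1 := h0 v hv
      simp only [cutForm, Function.iterate_zero, id_eq] at h1
      have ht0 : 0 ≤ t := by linarith
      have h5 := mul_nonneg ht0 (sub_nonneg.2 h1)
      have h6 : 0 ≤ 1 - 3 * t ^ 2 + 2 * t - 8 * t * 4340 / 4509 := by nlinarith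
      have h7 := mul_nonneg h6 (sub_nonneg.2 hFA)
      have h8 := mul_nonneg ht0 (sub_nonneg.2 ht)
      linarith

/-- If `K` avoids `A`, `C` and `E`, it touches `CD` far from `C`, because the facing point on `FA` is
outside the triangle cut off from `A`. -/
theorem fits_of_avoids_alternating (hK : InscribedInHexagon K) (h0 : Avoids K 1 0)
    (h2 : Avoids K 1 2) (h4 : Avoids K 1 4) : Fits K := by
  refine Fits.of_subset (hK.subset_covering h2 h4 (Or.inl ?_))
  obtain ⟨p, hp, q, hq, e, e', e''⟩ := hK.touch_CD
  refine ⟨p, hp, e, ?_⟩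
  have h1 := h0 q hq
  simp only [cutForm, Function.iterate_zero, id_eq] at h1
  linarith

theorem fits_of_avoids_alternating_add (k : ℕ) : ∀ {K : Set Plane}, InscribedInHexagon K →
    Avoids K 1 k → Avoids K 1 (k + 2) → Avoids K 1 (k + 4) → Fits K := by
  induction k with
  | zero => exact fun hK => hK.fits_of_avoids_alternating
  | succ k ih =>
    intro K hK h0 h2 h4
    refine Fits.of_image hexRotation (ih hK.hexRotation_image ?_ ?_ ?_) <;>
    rw [avoids_hexRotation_image]
    exacts [h0, h2, h4]

/-- A set which avoids the cuts at `C` and `E` has a copy in the covering.  The only sets for which neither the cuts of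
the opposite slant nor a reflection help would touch `CD` close to `C` and `EF` close to `F`, and
these touching points are too far apart. -/
theorem fits_of_avoids_two_four (hK : InscribedInHexagon K) (h2 : Avoids K 1 2)
    (h4 : Avoids K 1 4) : Fits K := by
  have hor := hK.avoids_or_avoids_add_three (σ := -1) (by norm_num)
  rcases hor 0 with h0' | h3'
  · exact Fits.of_subset (hK.subset_covering h2 h4 (Or.inr h0'))
  obtain ⟨p, hp, -, -, e, -, -⟩ := hK.touch_CD
  rcases hor 2 with h2' | h5'
  · refine Fits.of_subset (hK.subset_covering h2 h4 (Or.inl ⟨p, hp, e, ?_⟩))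
    have h1 := h2' p hp
    simp only [cutForm, Function.iterate_succ, Function.iterate_zero, Function.comp_apply, id_eq,
      xc_hexRotation, yc_hexRotation] at h1
    linarith
  rcases hor 1 with h1' | h4'
  · exact Fits.of_image mirror (fits_of_avoids_alternating_add 1 hK.mirror_image
      (avoids_mirror_image (j := 5) rfl h5') (avoids_mirror_image (j := 3) rfl h3')
      (avoids_mirror_image (j := 1) rfl h1'))
  by_cases hpC : xc p ≤ 36603 / 100000
  · exact Fits.of_subset (hK.subset_covering h2 h4 (Or.inl ⟨p, hp, e, hpC⟩))
  -- The reflection which exchanges `D` and `E` carries `EF` to `CD`.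
  obtain ⟨-, -, q, hq, -, eq', -⟩ := hK.touch_BC
  refine Fits.of_image hexRotation (Fits.of_image mirror (Fits.of_subset ?_))
  refine hK.hexRotation_image.mirror_image.subset_covering
    (avoids_mirror_image (j := 4) rfl (avoids_hexRotation_image.2 h5'))
    (avoids_mirror_image (j := 2) rfl (avoids_hexRotation_image.2 h3'))
    (Or.inl ⟨_, ⟨_, ⟨q, hq, rfl⟩, rfl⟩, ?_⟩)
  simp only [xc_mirror, yc_mirror, xc_hexRotation, yc_hexRotation]
  refine ⟨by linarith, ?_⟩
  by_contra! hq'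
  have hd := hK.dist_le p hp q hq
  have h6 : yc p = xc p - 1 := by linarith
  rw [h6, eq'] at hd
  push Not at hpC
  have h7 : xc p ≤ 1 / 2 := by nlinarith [sq_nonneg (xc p - 1 - yc q)]
  have h8 : (123206 / 100000 - xc p) ^ 2 ≤ (xc p - 1 - yc q) ^ 2 := by nlinarith
  nlinarith

theorem fits_of_avoids_add_two_add_four (k : ℕ) : ∀ {K : Set Plane}, InscribedInHexagon K →
    Avoids K 1 (k + 2) → Avoids K 1 (k + 4) → Fits K := by
  induction k with
  | zero => exact fun hK => hK.fits_of_avoids_two_four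
  | succ k ih =>
    intro K hK h2 h4
    refine Fits.of_image hexRotation (ih hK.hexRotation_image ?_ ?_) <;>
    rw [avoids_hexRotation_image]
    exacts [h2, h4]

/-- Among the corners chosen one from each opposite pair, two have exactly one corner between
them. -/
theorem fits (hK : InscribedInHexagon K) : Fits K := by
  have hor := hK.avoids_or_avoids_add_three (σ := 1) (by norm_num)
  rcases hor 0 with h0 | h3 <;> rcases hor 1 with h1 | h4 <;> rcases hor 2 with h2 | h5
  · exact fits_of_avoids_add_two_add_four 4 hK h0.add_six h2.add_six
  · exact fits_of_avoids_add_two_add_four 3 hK h5 h1.add_six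
  · exact fits_of_avoids_add_two_add_four 4 hK h0.add_six h2.add_six
  · exact fits_of_avoids_add_two_add_four 2 hK h4 h0.add_six
  · exact fits_of_avoids_add_two_add_four 5 hK h1.add_six h3.add_six
  · exact fits_of_avoids_add_two_add_four 1 hK h3 h5
  · exact fits_of_avoids_add_two_add_four 0 hK h2 h4
  · exact fits_of_avoids_add_two_add_four 1 hK h3 h5

end InscribedInHexagon

theorem isUniversalCovering_covering : IsUniversalCovering covering := by
  refine ⟨convex_covering, fun A hA => ?_⟩
  obtain ⟨K, hAK, hne, hcomp, hK, hmax⟩ := exists_isCompact_maximal hA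
  obtain ⟨g, hg⟩ := (isConstantWidthOne_of_maximal hne hcomp hK hmax).exists_inscribedInHexagon
  obtain ⟨f, hf⟩ := Fits.of_image g hg.fits
  exact ⟨f '' A, (Set.image_mono hAK).trans hf, 
    ⟨⟨f.toEquiv.image A, Isometry.of_dist_eq fun x y => f.isometry.dist_eq x y⟩⟩⟩

/-! ### The area of the covering -/

/-- The area of a trapezoid with two vertical sides. -/
theorem volume_trapezoid_le {a b u₀ u₁ l₀ l₁ : ℝ} (hab : a < b) (h₀ : l₀ ≤ u₀) (h₁ : l₁ ≤ u₁) :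
    MeasureTheory.volume {v : Plane | xc v ∈ Set.Icc a b ∧
      yc v * (b - a) ≤ u₀ * (b - xc v) + u₁ * (xc v - a) ∧
      l₀ * (b - xc v) + l₁ * (xc v - a) ≤ yc v * (b - a)} ≤
    ENNReal.ofReal ((b - a) * (u₀ + u₁ - l₀ - l₁) / 2 / √3) := by
  have h3 : 0 < √3 := by positivity
  have hba : 0 < b - a := sub_pos.2 hab
  let T : Set (ℝ × ℝ) := {p | p.1 ∈ Set.Icc a b ∧
    √3 * p.2 * (b - a) ≤ u₀ * (b - p.1) + u₁ * (p.1 - a) ∧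
    l₀ * (b - p.1) + l₁ * (p.1 - a) ≤ √3 * p.2 * (b - a)}
  have hT : MeasurableSet T := by
    refine IsClosed.measurableSet (IsClosed.inter ?_ (IsClosed.inter ?_ ?_))
    · exact isClosed_Icc.preimage continuous_fst
    · exact isClosed_le (f := fun p : ℝ × ℝ => √3 * p.2 * (b - a))
        (g := fun p => u₀ * (b - p.1) + u₁ * (p.1 - a)) (by fun_prop) (by fun_prop)
    · exact isClosed_le (f := fun p : ℝ × ℝ => l₀ * (b - p.1) + l₁ * (p.1 - a))
        (g := fun p => √3 * p.2 * (b - a)) (by fun_prop) (by fun_prop)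
  have hmp : MeasureTheory.MeasurePreserving (fun v : Plane => ((v 0, v 1) : ℝ × ℝ)) :=
    (MeasureTheory.volume_preserving_finTwoArrow ℝ).comp (PiLp.volume_preserving_ofLp (Fin 2))
  let f : ℝ → ℝ := fun x =>
    ((u₀ - l₀) * (b - x) + (u₁ - l₁) * (x - a)) / (b - a) / √3
  have hf : ∀ x ∈ Set.Icc a b, 0 ≤ f x := fun x hx => by
    have h4 := mul_nonneg (sub_nonneg.2 h₀) (sub_nonneg.2 hx.2)
    have h5 := mul_nonneg (sub_nonneg.2 h₁) (sub_nonneg.2 hx.1)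
    positivity
  have hslice : ∀ x, MeasureTheory.volume (Prod.mk x ⁻¹' T) ≤
      (Set.Icc a b).indicator (fun x => ENNReal.ofReal (f x)) x := by
    intro x
    by_cases hx : x ∈ Set.Icc a b
    · rw [Set.indicator_of_mem hx]
      refine (MeasureTheory.measure_mono (t := Set.Icc
        ((l₀ * (b - x) + l₁ * (x - a)) / (b - a) / √3)
        ((u₀ * (b - x) + u₁ * (x - a)) / (b - a) / √3)) ?_).trans ?_
      · rintro y ⟨-, hy, hy'⟩
        constructor
        · rw [div_div, div_le_iff₀ (by positivity)]
          simp only at hy'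
          linarith
        · rw [div_div, le_div_iff₀ (by positivity)]
          simp only at hy
          linarith
      · rw [Real.volume_Icc]
        refine le_of_eq (congrArg _ ?_)
        simp only [f]
        ring
    · rw [Set.indicator_of_notMem hx]
      refine le_of_eq (MeasureTheory.measure_mono_null (t := ∅) ?_ (by simp))
      rintro y ⟨hy, -⟩
      exact hx hy
  have hint : ∫ x in a..b, f x = (b - a) * (u₀ + u₁ - l₀ - l₁) / 2 / √3 := by
    have hF : ∀ x ∈ Set.uIcc a b, HasDerivAt
        (fun x => ((u₁ - l₁) * (x - a) ^ 2 - (u₀ - l₀) * (b - x) ^ 2) / 2 / (b - a) / √3) (f x) x := by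
      intro x _
      have h4 := (((hasDerivAt_id x).sub_const a).pow 2).const_mul (u₁ - l₁)
      have h5 := (((hasDerivAt_id x).const_sub b).pow 2).const_mul (u₀ - l₀)
      refine ((((h4.sub h5).div_const 2).div_const (b - a)).div_const √3).congr_deriv ?_
      simp only [f, id]
      ring
    rw [intervalIntegral.integral_eq_sub_of_hasDerivAt hF
      (Continuous.intervalIntegrable (by fun_prop) _ _)]
    field_simp
    ring
  calc _ = MeasureTheory.volume ((fun v : Plane => ((v 0, v 1) : ℝ × ℝ)) ⁻¹' T) := rfl
    _ = MeasureTheory.volume T := hmp.measure_preimage hT.nullMeasurableSet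
    _ = ∫⁻ x, MeasureTheory.volume (Prod.mk x ⁻¹' T) := by
      rw [MeasureTheory.Measure.volume_eq_prod, MeasureTheory.Measure.prod_apply hT]
    _ ≤ ∫⁻ x, (Set.Icc a b).indicator (fun x => ENNReal.ofReal (f x)) x :=
      MeasureTheory.lintegral_mono hslice
    _ = ∫⁻ x in Set.Icc a b, ENNReal.ofReal (f x) :=
      MeasureTheory.lintegral_indicator measurableSet_Icc _
    _ = ENNReal.ofReal (∫ x in Set.Icc a b, f x) := by
      refine (MeasureTheory.ofReal_integral_eq_lintegral_ofReal ?_ ?_).symm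
      · exact (Continuous.continuousOn (by fun_prop)).integrableOn_Icc
      · exact (MeasureTheory.ae_restrict_iff' measurableSet_Icc).2 (Filter.Eventually.of_forall hf)
    _ = _ := by
      rw [MeasureTheory.integral_Icc_eq_integral_Ioc, ← intervalIntegral.integral_of_le hab.le, hint]

/-- The bound `s / √3` holds for the area of the part of `U` to the left of the abscissa `b`. -/
def LeftAreaLE (U : Set Plane) (b s : ℝ) : Prop :=
  MeasureTheory.volume {v ∈ U | xc v < b} ≤ ENNReal.ofReal (s / √3)

/-- A half plane which lies below the points `(b, u₀)` and `(c, u₁)` lies below their chord. -/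
theorem mul_le_chord {α β γ b c u₀ u₁ x y : ℝ} (hbc : b < c) (h : α * x + β * y ≤ γ)
    (hb : γ - α * b ≤ β * u₀) (hc : γ - α * c ≤ β * u₁) (hx : x ∈ Set.Icc b c) :
    β * (y * (c - b)) ≤ β * (u₀ * (c - x) + u₁ * (x - b)) := by
  have h1 := mul_le_mul_of_nonneg_right h (sub_nonneg.2 hbc.le)
  have h2 := mul_le_mul_of_nonneg_right hb (sub_nonneg.2 hx.2)
  have h3 := mul_le_mul_of_nonneg_right hc (sub_nonneg.2 hx.1)
  linarith

/-- Extends a bound for the area of a part of `U` by the trapezoid with vertices `(b, l₀)`, `(c, l₁)`,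
`(c, u₁)`, `(b, u₀)`, when `U` lies below the line `α x + β y = γ` and above `α' x + β' y = γ'`. -/
theorem LeftAreaLE.step {U : Set Plane} {b s α β γ α' β' γ' : ℝ} (h : LeftAreaLE U b s)
    (hup : ∀ v ∈ U, α * xc v + β * yc v ≤ γ) (hlo : ∀ v ∈ U, α' * xc v + β' * yc v ≤ γ')
    (c u₀ u₁ l₀ l₁ : ℝ) (hnum : 0 ≤ s ∧ b < c ∧ l₀ ≤ u₀ ∧ l₁ ≤ u₁ ∧ 0 < β ∧ β' < 0 ∧
      γ - α * b ≤ β * u₀ ∧ γ - α * c ≤ β * u₁ ∧ γ' - α' * b ≤ β' * l₀ ∧ γ' - α' * c ≤ β' * l₁) :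
    LeftAreaLE U c (s + (c - b) * (u₀ + u₁ - l₀ - l₁) / 2) := by
  obtain ⟨hs, hbc, h0, h1, hβ, hβ', e1, e2, e3, e4⟩ := hnum
  have hsub : {v ∈ U | xc v < c} ⊆ {v ∈ U | xc v < b} ∪
      {v : Plane | xc v ∈ Set.Icc b c ∧
        yc v * (c - b) ≤ u₀ * (c - xc v) + u₁ * (xc v - b) ∧
        l₀ * (c - xc v) + l₁ * (xc v - b) ≤ yc v * (c - b)} := by
    rintro v ⟨hv, hc⟩
    rcases lt_or_ge (xc v) b with hb | hb
    · exact Or.inl ⟨hv, hb⟩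
    · have hbc' : xc v ∈ Set.Icc b c := ⟨hb, hc.le⟩
      exact Or.inr ⟨hbc', (mul_le_mul_iff_right₀ hβ).1 (mul_le_chord hbc (hup v hv) e1 e2 hbc'),
        (mul_le_mul_left_of_neg hβ').1 (mul_le_chord hbc (hlo v hv) e3 e4 hbc')⟩
  refine (MeasureTheory.measure_mono hsub).trans ((MeasureTheory.measure_union_le _ _).trans ?_)
  rw [add_div, ENNReal.ofReal_add (by positivity) (by
    have : 0 < c - b := sub_pos.2 hbc
    have : 0 ≤ u₀ + u₁ - l₀ - l₁ := by linarith
    positivity)]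
  exact add_le_add h (volume_trapezoid_le hbc h0 h1)

theorem covering_tangent_AB {t : ℝ} (ht : 0 ≤ t) : ∀ v ∈ covering,
    (1 - 3 * t ^ 2 - 6 * t) * xc v + (1 - 3 * t ^ 2 + 2 * t) * yc v ≤
      2 * (1 + 3 * t ^ 2) - (1 - 3 * t ^ 2 - 6 * t) * (35 / 97) -
        (1 - 3 * t ^ 2 + 2 * t) * (62 / 97) := by
  rintro v ⟨-, -, -, -, -, -, -, -, h, -⟩
  linarith [h t ht]

theorem covering_tangent_FA {t : ℝ} (ht : 7 / 2000 ≤ t) (ht' : t ≤ 1 / 10) : ∀ v ∈ covering,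
    -(1 - 3 * t ^ 2 - 6 * t) * xc v + (1 - 3 * t ^ 2 + 2 * t) * yc v ≤
      2 * (1 + 3 * t ^ 2) - (1 - 3 * t ^ 2 - 6 * t) * (36603 / 100000) -
        (1 - 3 * t ^ 2 + 2 * t) * (63397 / 100000) := by
  rintro v ⟨-, -, -, -, -, -, -, -, -, h⟩
  linarith [h t ht ht']

/-- The area is bounded by that of a polygon, cut into trapezoids by verticals through its vertices.
Its vertices are `B`, `D`, `F`, the ends of the cuts at `E` and `C`, and the intersections, rounded
outwards, of consecutive lines among `FA`, the tangents for `t = k / 150` with `1 ≤ k ≤ 6`, and `AB`. -/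
theorem volume_covering_le : MeasureTheory.volume covering ≤ ENNReal.ofReal 0.8441153 := by
  have hFA : ∀ v ∈ covering, (-1) * xc v + 1 * yc v ≤ 1 := by
    rintro v ⟨-, -, -, -, h, -⟩
    linarith
  have hAB : ∀ v ∈ covering, 1 * xc v + 1 * yc v ≤ 1 := by
    rintro v ⟨-, -, h, -⟩
    linarith
  have hDE : ∀ v ∈ covering, (-1) * xc v + (-1) * yc v ≤ 1 := by
    rintro v ⟨-, -, -, h, -⟩
    linarith
  have hCD : ∀ v ∈ covering, 1 * xc v + (-1) * yc v ≤ 1 := by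
    rintro v ⟨-, -, -, -, -, h, -⟩
    linarith
  have hE : ∀ v ∈ covering, (-12851) * xc v + (-4509) * yc v ≤ 7519 := by
    rintro v ⟨-, -, -, -, -, -, -, h, -⟩
    simp only [cutForm, Function.iterate_succ, Function.iterate_zero, Function.comp_apply, id_eq,
      xc_hexRotation, yc_hexRotation] at h
    linarith
  have hC : ∀ v ∈ covering, 13189 * xc v + (-4171) * yc v ≤ 7519 := by
    rintro v ⟨-, -, -, -, -, -, h, -⟩
    simp only [cutForm, Function.iterate_succ, Function.iterate_zero, Function.comp_apply, id_eq,
      xc_hexRotation, yc_hexRotation] at h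
    linarith
  have h : LeftAreaLE covering (-1 / 2) 0 := by
    refine le_of_eq_of_le (MeasureTheory.measure_mono_null (t := ∅) ?_ (by simp)) zero_le
    rintro v ⟨⟨-, hv, -⟩, hv'⟩
    exact (not_lt.2 hv hv').elim
  replace h := h.step hFA hE
    (-35 / 97) (1 / 2) (62 / 97) (-81 / 334) (-62 / 97) (by norm_num)
  replace h := h.step hFA hDE
    (-0.12397) (62 / 97) 0.87603 (-62 / 97) (-0.87603) (by norm_num)
  replace h := h.step (covering_tangent_FA (t := 1 / 150) (by norm_num) (by norm_num)) hDE
    (-0.10371) 0.87603 0.8952236 (-0.87603) (-0.89629) (by norm_num)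
  replace h := h.step (covering_tangent_FA (t := 2 / 150) (by norm_num) (by norm_num)) hDE
    (-0.08321) 0.8952236 0.9135925 (-0.89629) (-0.91679) (by norm_num)
  replace h := h.step (covering_tangent_FA (t := 3 / 150) (by norm_num) (by norm_num)) hDE
    (-0.06248) 0.9135925 0.9311296 (-0.91679) (-0.93752) (by norm_num)
  replace h := h.step (covering_tangent_FA (t := 4 / 150) (by norm_num) (by norm_num)) hDE
    (-0.04155) 0.9311296 0.9478118 (-0.93752) (-0.95845) (by norm_num)
  replace h := h.step (covering_tangent_FA (t := 5 / 150) (by norm_num) (by norm_num)) hDE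
    (-0.02042) 0.9478118 0.9636427 (-0.95845) (-0.97958) (by norm_num)
  replace h := h.step (covering_tangent_FA (t := 6 / 150) (by norm_num) (by norm_num)) hDE
    (-0.0011) 0.9636427 0.9772125 (-0.97958) (-0.9989) (by norm_num)
  replace h := h.step (covering_tangent_AB (t := 6 / 150) (by norm_num)) hDE
    0 0.9772125 (663 / 679) (-0.9989) (-1) (by norm_num)
  replace h := h.step (covering_tangent_AB (t := 6 / 150) (by norm_num)) hCD
    0.02563 (663 / 679) 0.958434 (-1) (-0.97437) (by norm_num)
  replace h := h.step (covering_tangent_AB (t := 5 / 150) (by norm_num)) hCD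
    0.04676 0.958434 0.942603 (-0.97437) (-0.95324) (by norm_num)
  replace h := h.step (covering_tangent_AB (t := 4 / 150) (by norm_num)) hCD
    0.06769 0.942603 0.9259203 (-0.95324) (-0.93231) (by norm_num)
  replace h := h.step (covering_tangent_AB (t := 3 / 150) (by norm_num)) hCD
    0.08842 0.9259203 0.9083832 (-0.93231) (-0.91158) (by norm_num)
  replace h := h.step (covering_tangent_AB (t := 2 / 150) (by norm_num)) hCD
    0.10892 0.9083832 0.890014 (-0.91158) (-0.89108) (by norm_num)
  replace h := h.step (covering_tangent_AB (t := 1 / 150) (by norm_num)) hCD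
    0.12918 0.890014 0.8708203 (-0.89108) (-0.87082) (by norm_num)
  replace h := h.step hAB hCD
    (62 / 167) 0.8708203 (105 / 167) (-0.87082) (-105 / 167) (by norm_num)
  replace h := h.step hAB hC
    (500001 / 1000000) (105 / 167) 0.499999 (-105 / 167) (-0.2216464) (by norm_num)
  -- The last abscissa exceeds `1/2`, so that no part of the covering is left.
  have hsub : covering ⊆ {v ∈ covering | xc v < 500001 / 1000000} := fun v hv =>
    ⟨hv, by linarith [hv.1]⟩
  refine (MeasureTheory.measure_mono hsub).trans (h.trans (ENNReal.ofReal_le_ofReal ?_))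
  have h3 : (1.7320508 : ℝ) ≤ √3 := Real.le_sqrt_of_sq_le (by norm_num)
  rw [div_le_iff₀ (by positivity)]
  refine le_trans ?_ (mul_le_mul_of_nonneg_left h3 (by norm_num))
  norm_num

theorem mainTheorem1 :
    ∃ U : Set Plane, IsUniversalCovering U ∧
      MeasureTheory.volume U ≤ ENNReal.ofReal 0.8441153 :=
  ⟨covering, isUniversalCovering_covering, volume_covering_le⟩
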